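/- Let $n\ge 1$. A lattice in $\mathbb{Q}^n$ is a $\mathbb{Z}$-submodule of $\mathbb{Q}^n$ that is free with $n$ generators; let $\mathrm{Lat}_n(\mathbb{Q})$ be the set of all lattices in $\mathbb{Q}^n$. Let $e_1,\dots,e_n$ be the standard basis of $\mathbb{Q}^n$, and for $1\le k\le n$ put $$\mathbb{Q}^k=\mathbb{Q}e_1\oplus\dots\oplus\mathbb{Q}e_k,\qquad \mathbb{Z}^k=\mathbb{Z}e_1\oplus\dots\oplus\mathbb{Z}e_k .$$ For a lattice $L$ in $\mathbb{Q}^k\subset\mathbb{R}^k$, let $\upsilon_k(L)$ be the volume of the torus $\mathbb{R}^k/L$. Let $\alpha_1,\dots,\alpha_n,\beta_1,\dots,\beta_n$ be complex numbers, put $\alpha_{n+1}=\beta_{n+1}=0$, and assume that for all $1\le j\le n$ $$\operatorname{Re}\alpha_j-n+1>1,\qquad \operatorname{Re}\alpha_j+\operatorname{Re}\beta_j-n+j>1,\qquad \operatorname{Re}\beta_j+j<0 .$$ Then the following series converges absolutely, and $$\sum_{R\in\mathrm{Lat}_n(\mathbb{Q})}\ \prod_{k=1}^n \upsilon_k(R\cap\mathbb{Q}^k)^{-\beta_k+\beta_{k+1}}\,\upsilon_k(R\cap\mathbb{Z}^k)^{-\alpha_k+\alpha_{k+1}}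 =\prod_{j=1}^n\frac{\zeta(-(\beta_j+j-1))\,\zeta(\alpha_j+\beta_j-n+j)}{\zeta(\alpha_j-n+j)},$$ where $\zeta$ is the Riemann zeta-function. -/

import Mathlib

noncomputable section

namespace QLattice

/-- `R` is a lattice in `ℚⁿ`: a free `ℤ`-submodule with `n` generators. -/
def IsLattice (n : ℕ) (R : Submodule ℤ (Fin n → ℚ)) : Prop :=
  Nonempty (Module.Basis (Fin n) ℤ R)

/-- The space of all lattices in `ℚⁿ`. -/
def Lat (n : ℕ) : Type :=
  {R : Submodule ℤ (Fin n → ℚ) // IsLattice n R}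

/-- The first `k` vectors of the standard basis of `ℚⁿ`. -/
def firstBasisVectors (n k : ℕ) : Set (Fin n → ℚ) :=
  {v | ∃ i : Fin n, (i : ℕ) < k ∧ v = Pi.single i 1}

/-- `ℚᵏ = ℚ e₁ ⊕ ⋯ ⊕ ℚ eₖ ⊆ ℚⁿ`, seen as a `ℤ`-submodule of `ℚⁿ`. -/
def ratFlag (n k : ℕ) : Submodule ℤ (Fin n → ℚ) :=
  (Submodule.span ℚ (firstBasisVectors n k)).restrictScalars ℤ

/-- `ℤᵏ = ℤ e₁ ⊕ ⋯ ⊕ ℤ eₖ ⊆ ℚⁿ`. -/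
def intFlag (n k : ℕ) : Submodule ℤ (Fin n → ℚ) :=
  Submodule.span ℤ (firstBasisVectors n k)

/-- The first `k` coordinates of a vector of `ℚⁿ`, as a vector of `ℝᵏ`. It is used for `k ≤ n`
only, where the `else` branch does not occur; on `ℚᵏ ⊆ ℚⁿ` it is the natural embedding
`ℚᵏ ⊆ ℝᵏ`. -/
def realCoords (n k : ℕ) : (Fin n → ℚ) →ₗ[ℤ] (Fin k → ℝ) where
  toFun x := fun i => if h : (i : ℕ) < n then ((x ⟨i, h⟩ : ℚ) : ℝ) else 0
  map_add' x y := by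
    funext i
    by_cases h : (i : ℕ) < n <;> simp [h]
  map_smul' c x := by
    funext i
    by_cases h : (i : ℕ) < n <;> simp [h]

/-- `υₖ(L)`, for a subgroup `L` of `ℚᵏ ⊆ ℚⁿ` (`k ≤ n`): the volume of the torus `ℝᵏ / L`,
with respect to Lebesgue measure on `ℝᵏ`. -/
def torusVolume {n : ℕ} (k : ℕ) (L : Submodule ℤ (Fin n → ℚ)) : ℝ :=
  ZLattice.covolume (L.map (realCoords n k))

end QLattice

end

/-! A lattice `R` has a diagonal `d_0, …, d_{n-1}`: `d_k` is the positive generator of the group of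
`k`-th coordinates of `R ∩ ℚᵏ⁺¹`. A triangular basis shows that the volume attached to `R ∩ ℚᵏ` is
`∏_{i<k} d_i` (`torusVolume_inf_ratFlag`). The exponents therefore telescope, and the summand
becomes `∏ d_i(R)^(-β_{i+1}) · ∏ d_i(R ∩ ℤⁿ)^(-α_{i+1})` (`summand_eq`).

The awkward factor `R ∩ ℤⁿ` is removed by summing over its sublattices. A lattice `M` has `∏
a_i^(n-1-i)` sublattices with diagonal `a_i d_i(M)` (`card_sub`). So the sum of `∏
d_i(L)^(-α_{i+1})` over `L ⊆ M` is `∏ d_i(M)^(-α_{i+1})` times the denominator `∏ ζ(α_j - n + j)`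
(`hasSum_sublattices`). Multiplied by this nonzero constant, the required series is a sum over pairs
`L ⊆ R` with `L ⊆ ℤⁿ`.

The pairs are counted in the other order: first `L ⊆ ℤⁿ` with diagonal `a`, then `R ⊇ L` with
diagonal `a_i / c_i`, for which there are `∏ c_i^i` choices (`card_super`). The sum splits into
independent Dirichlet series in the `a_i` and the `c_i`, which give the two zeta factors of the
numerator (`hasSum_pairs`). -/

namespace QLattice

/-! ### Summation over fibres and products of zeta series -/

theorem hasSum_fiber {X Y E : Type*} [NormedRing E] (π : X → Y) (g : Y → E) (y : Y)
    (hy : Nat.card {x // π x = y} ≠ 0) :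
    HasSum (fun x : {x // π x = y} => g (π x.1)) ((Nat.card {x // π x = y} : E) * g y) := by
  have := Nat.finite_of_card_ne_zero hy
  have := Fintype.ofFinite {x // π x = y}
  have h1 := hasSum_fintype (fun _ : {x // π x = y} => g y)
  rw [Finset.sum_const, Finset.card_univ, ← Nat.card_eq_fintype_card, nsmul_eq_mul] at h1
  convert! h1 using 3 with x
  exact x.2

/-- A series whose terms only depend on the image under a map with finite fibres is summed by
counting the fibres. -/
theorem hasSum_comp_of_card_fiber {X Y : Type*} (π : X → Y) (N : Y → ℕ)
    (hN : ∀ y, Nat.card {x // π x = y} = N y) (hN0 : ∀ y, N y ≠ 0) (g : Y → ℂ) {S : ℂ}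
    (h : HasSum (fun y => (N y : ℂ) * g y) S) : HasSum (fun x => g (π x)) S := by
  have hfib : ∀ y, HasSum (fun x : {x // π x = y} => g (π x.1)) ((N y : ℂ) * g y) := fun y =>
    hN y ▸ hasSum_fiber π g y (hN y ▸ hN0 y)
  have hfibn : ∀ y, HasSum (fun x : {x // π x = y} => ‖g (π x.1)‖) ((N y : ℝ) * ‖g y‖) := fun y =>
    hN y ▸ hasSum_fiber π (fun y => ‖g y‖) y (hN y ▸ hN0 y)
  rw [← (Equiv.sigmaFiberEquiv π).hasSum_iff]
  refine h.sigma_of_hasSum hfib ?_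
  -- The norm is constant on each finite fibre, so the norms over a fibre add up to the norm of the
  -- grouped term.
  refine Summable.of_norm ?_
  rw [summable_sigma_of_nonneg (fun _ => norm_nonneg _)]
  refine ⟨fun y => (hfibn y).summable, ?_⟩
  refine h.summable.norm.congr fun y => ?_
  rw [norm_mul, Complex.norm_natCast]
  exact ((hfibn y).tsum_eq).symm

theorem hasSum_mul_complex {X Y : Type*} {f : X → ℂ} {g : Y → ℂ} {s t : ℂ} (hf : HasSum f s)
    (hg : HasSum g t) : HasSum (fun x : X × Y => f x.1 * g x.2) (s * t) := by
  have h := summable_mul_of_summable_norm hf.summable.norm hg.summable.norm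
  exact hf.mul hg h

theorem hasSum_prod_pi {n : ℕ} {ι : Type*} (f : Fin n → ι → ℂ) (s : Fin n → ℂ)
    (h : ∀ i, HasSum (f i) (s i)) :
    HasSum (fun a : Fin n → ι => ∏ i, f i (a i)) (∏ i, s i) := by
  induction n with
  | zero => simp
  | succ n ih =>
    have h1 := ih (fun i => f i.succ) (fun i => s i.succ) (fun i => h i.succ)
    have h2 := hasSum_mul_complex (h 0) h1
    rw [← (Fin.consEquiv fun _ : Fin (n + 1) => ι).hasSum_iff, Fin.prod_univ_succ]
    convert! h2 using 1
    funext x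
    simp [Fin.consEquiv, Fin.prod_univ_succ]

theorem hasSum_pnat_cpow {s : ℂ} (hs : 1 < s.re) :
    HasSum (fun a : ℕ+ => (a : ℂ) ^ (-s)) (riemannZeta s) := by
  have h0 : Summable (fun n : ℕ => 1 / (n : ℂ) ^ s) := Complex.summable_one_div_nat_cpow.2 hs
  have h1 : HasSum (fun n : ℕ => 1 / (n : ℂ) ^ s) (riemannZeta s) := by
    rw [zeta_eq_tsum_one_div_nat_cpow hs]; exact h0.hasSum
  -- The term at `0` vanishes, since `0 ^ s = 0` for `s ≠ 0` and `1 / 0 = 0`.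
  have h2 : Function.support (fun n : ℕ => 1 / (n : ℂ) ^ s) ⊆ Set.range ((↑) : ℕ+ → ℕ) := by
    intro m hm
    rcases Nat.eq_zero_or_pos m with rfl | hm'
    · have : s ≠ 0 := by rintro rfl; norm_num at hs
      simp [this] at hm
    · exact ⟨⟨m, hm'⟩, rfl⟩
  rw [← Function.Injective.hasSum_iff PNat.coe_injective
    (fun x hx => by by_contra h; exact hx (h2 h))] at h1
  convert! h1 using 1
  funext x
  simp [Complex.cpow_neg]

theorem hasSum_prod_pnat_cpow {n : ℕ} (s : Fin n → ℂ) (hs : ∀ i, 1 < (s i).re) :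
    HasSum (fun a : Fin n → ℕ+ => ∏ i, (a i : ℂ) ^ (-s i)) (∏ i, riemannZeta (s i)) :=
  hasSum_prod_pi (fun i (a : ℕ+) => (a : ℂ) ^ (-s i)) _ fun i => hasSum_pnat_cpow (hs i)

/-! ### The flags in coordinates -/

variable {n : ℕ}

/-- The `k`-th coordinate on `ℚⁿ`, or zero if `n ≤ k`. -/
noncomputable def coord (n k : ℕ) : (Fin n → ℚ) →ₗ[ℤ] ℚ :=
  if h : k < n then LinearMap.proj (⟨k, h⟩ : Fin n) else 0

theorem coord_apply {k : ℕ} (h : k < n) (x : Fin n → ℚ) : coord n k x = x ⟨k, h⟩ := by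
  simp [coord, h]

theorem mem_ratFlag {k : ℕ} {x : Fin n → ℚ} :
    x ∈ ratFlag n k ↔ ∀ i : Fin n, k ≤ i → x i = 0 := by
  rw [ratFlag, Submodule.restrictScalars_mem]
  constructor
  · intro hx i hi
    have : Submodule.span ℚ (firstBasisVectors n k) ≤
        LinearMap.ker (LinearMap.proj i : (Fin n → ℚ) →ₗ[ℚ] ℚ) := by
      rw [Submodule.span_le]
      rintro _ ⟨j, hj, rfl⟩
      have : i ≠ j := by rintro rfl; omega
      simp [this]
    exact this hx
  · intro hx
    rw [pi_eq_sum_univ' x]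
    refine Submodule.sum_mem _ fun i _ => ?_
    by_cases hi : k ≤ i
    · simp [hx i hi]
    · refine Submodule.smul_mem _ _ (Submodule.subset_span ⟨i, not_le.1 hi, ?_⟩)
      funext j; simp [Pi.single_apply, eq_comm]

theorem mem_intFlag {k : ℕ} {x : Fin n → ℚ} :
    x ∈ intFlag n k ↔ x ∈ ratFlag n k ∧ ∀ i, ∃ z : ℤ, x i = z := by
  constructor
  · intro hx
    have h1 : intFlag n k ≤ ratFlag n k := by
      rw [intFlag, Submodule.span_le]
      exact fun v hv => Submodule.subset_span hv
    refine ⟨h1 hx, fun i => ?_⟩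
    have h2 : intFlag n k ≤ (Submodule.span ℤ {(1 : ℚ)}).comap
        (LinearMap.proj i : (Fin n → ℚ) →ₗ[ℤ] ℚ) := by
      rw [intFlag, Submodule.span_le]
      rintro _ ⟨j, hj, rfl⟩
      by_cases h : i = j
      · subst h; simp
      · simp [h]
    obtain ⟨z, hz⟩ := Submodule.mem_span_singleton.1 (h2 hx)
    exact ⟨z, by simpa using hz.symm⟩
  · rintro ⟨hx, hz⟩
    choose z hz using hz
    rw [pi_eq_sum_univ' x]
    refine Submodule.sum_mem _ fun i _ => ?_
    by_cases hi : k ≤ i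
    · simp [mem_ratFlag.1 hx i hi]
    · rw [hz, Int.cast_smul_eq_zsmul]
      refine Submodule.smul_mem _ _ (Submodule.subset_span ⟨i, not_le.1 hi, ?_⟩)
      funext j; simp [Pi.single_apply, eq_comm]

theorem ratFlag_mono {k l : ℕ} (h : k ≤ l) : ratFlag n k ≤ ratFlag n l :=
  fun _ hx => mem_ratFlag.2 fun i hi => mem_ratFlag.1 hx i (h.trans hi)

theorem ratFlag_top : ratFlag n n = ⊤ :=
  top_unique fun _ _ => mem_ratFlag.2 fun i hi => absurd i.2 (by omega)

theorem ratFlag_zero : ratFlag n 0 = ⊥ :=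
  bot_unique fun _ hx => funext fun i => mem_ratFlag.1 hx i (by omega)

theorem intFlag_eq (k : ℕ) : intFlag n k = intFlag n n ⊓ ratFlag n k := by
  ext x
  simp [mem_intFlag, ratFlag_top, and_comm]

theorem mem_ratFlag_of_coord {k : ℕ} {x : Fin n → ℚ} (hx : x ∈ ratFlag n (k + 1))
    (h0 : coord n k x = 0) : x ∈ ratFlag n k := by
  refine mem_ratFlag.2 fun i hi => ?_
  rcases hi.eq_or_lt with h | h
  · subst h; rwa [coord_apply i.2] at h0
  · exact mem_ratFlag.1 hx i h

theorem coord_eq_zero {k : ℕ} {x : Fin n → ℚ} (hx : x ∈ ratFlag n k) : coord n k x = 0 := by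
  by_cases h : k < n
  · rw [coord_apply h]; exact mem_ratFlag.1 hx ⟨k, h⟩ le_rfl
  · simp [coord, h]

/-! ### The diagonal of a subgroup -/

open Classical in
/-- The positive generator of a subgroup of `ℚ`, or zero if the subgroup is not infinite cyclic. -/
noncomputable def posGenerator (S : Submodule ℤ ℚ) : ℚ :=
  if h : ∃ d : ℚ, 0 < d ∧ S = Submodule.span ℤ {d} then h.choose else 0

/-- The positive generator of the group of `k`-th coordinates of the vectors of `R ∩ ℚᵏ⁺¹`, or zero
if that group is not infinite cyclic. -/
noncomputable def diag (R : Submodule ℤ (Fin n → ℚ)) (k : ℕ) : ℚ :=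
  posGenerator ((R ⊓ ratFlag n (k + 1)).map (coord n k))

theorem span_singleton_inj_of_pos {d e : ℚ} (hd : 0 < d) (he : 0 < e)
    (h : Submodule.span ℤ {d} = Submodule.span ℤ {e}) : d = e := by
  obtain ⟨a, ha⟩ := Submodule.mem_span_singleton.1 (h ▸ Submodule.mem_span_singleton_self d)
  obtain ⟨b, hb⟩ := Submodule.mem_span_singleton.1 (h.symm ▸ Submodule.mem_span_singleton_self e)
  simp only [zsmul_eq_mul] at ha hb
  have ha0 : 0 < a := by
    have : 0 < (a : ℚ) := pos_of_mul_pos_left (ha ▸ hd) he.le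
    exact_mod_cast this
  have hab : b * a = 1 := by
    have : ((b * a : ℤ) : ℚ) * e = 1 * e := by push_cast; rw [mul_assoc, ha, hb, one_mul]
    exact_mod_cast mul_right_cancel₀ he.ne' this
  have : a = 1 := by
    rcases Int.isUnit_iff.1 (IsUnit.of_mul_eq_one b (by rw [mul_comm]; exact hab)) with h | h <;> omega
  rw [← ha, this]; simp

variable {R L P : Submodule ℤ (Fin n → ℚ)} {k : ℕ}

/-- The default value of `posGenerator` is zero, so positivity of the diagonal entry certifies that
the coordinate group is infinite cyclic. -/
theorem map_coord_of_pos (h : 0 < diag R k) :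
    (R ⊓ ratFlag n (k + 1)).map (coord n k) = Submodule.span ℤ {diag R k} := by
  unfold diag posGenerator at h ⊢
  split_ifs with h'
  · exact h'.choose_spec.2
  · simp [h'] at h

theorem diag_eq {d : ℚ} (hd : 0 < d)
    (h : (R ⊓ ratFlag n (k + 1)).map (coord n k) = Submodule.span ℤ {d}) : diag R k = d := by
  have h' : ∃ d : ℚ, 0 < d ∧ (R ⊓ ratFlag n (k + 1)).map (coord n k) = Submodule.span ℤ {d} :=
    ⟨d, hd, h⟩
  rw [diag, posGenerator, dif_pos h']
  exact span_singleton_inj_of_pos h'.choose_spec.1 hd (h'.choose_spec.2.symm.trans h)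

theorem diag_inf_ratFlag {i : ℕ} (hi : i < k) : diag (R ⊓ ratFlag n k) i = diag R i := by
  rw [diag, diag, inf_assoc, inf_eq_right.2 (ratFlag_mono (n := n) (show i + 1 ≤ k from hi))]

theorem exists_coord_eq_diag (h : 0 < diag R k) :
    ∃ v ∈ R, v ∈ ratFlag n (k + 1) ∧ coord n k v = diag R k := by
  have := map_coord_of_pos h ▸ Submodule.mem_span_singleton_self (R := ℤ) (diag R k)
  obtain ⟨v, hv, hv'⟩ := this
  exact ⟨v, hv.1, hv.2, hv'⟩

theorem exists_coord_eq_mul (h : 0 < diag R k) {x : Fin n → ℚ} (hx : x ∈ R)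
    (hx' : x ∈ ratFlag n (k + 1)) : ∃ z : ℤ, coord n k x = z * diag R k := by
  have : coord n k x ∈ Submodule.span ℤ {diag R k} :=
    map_coord_of_pos h ▸ Submodule.mem_map_of_mem ⟨hx, hx'⟩
  obtain ⟨z, hz⟩ := Submodule.mem_span_singleton.1 this
  exact ⟨z, by rw [← hz, zsmul_eq_mul]⟩

/-! ### Extending a subgroup of `ℚᵏ` by one vector -/

section Extension

variable {v : Fin n → ℚ}

theorem sup_span_le (hP : P ≤ ratFlag n k) (hv : v ∈ ratFlag n (k + 1)) :
    P ⊔ Submodule.span ℤ {v} ≤ ratFlag n (k + 1) :=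
  sup_le (hP.trans (ratFlag_mono k.le_succ)) (by simpa using hv)

theorem mem_sup_span {x : Fin n → ℚ} :
    x ∈ P ⊔ Submodule.span ℤ {v} ↔ ∃ p ∈ P, ∃ z : ℤ, x = p + z • v := by
  simp only [Submodule.mem_sup, Submodule.mem_span_singleton]
  constructor
  · rintro ⟨p, hp, _, ⟨z, rfl⟩, rfl⟩; exact ⟨p, hp, z, rfl⟩
  · rintro ⟨p, hp, z, rfl⟩; exact ⟨p, hp, _, ⟨z, rfl⟩, rfl⟩

theorem sup_span_inf (hP : P ≤ ratFlag n k) (h0 : coord n k v ≠ 0) :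
    (P ⊔ Submodule.span ℤ {v}) ⊓ ratFlag n k = P := by
  refine le_antisymm ?_ (le_inf le_sup_left hP)
  rintro x ⟨hx, hx'⟩
  obtain ⟨p, hp, z, rfl⟩ := mem_sup_span.1 hx
  have := coord_eq_zero hx'
  rw [map_add, coord_eq_zero (hP hp), zero_add, map_zsmul, smul_eq_zero] at this
  simpa [this.resolve_right h0] using hp

theorem diag_sup_span (hP : P ≤ ratFlag n k) (hv : v ∈ ratFlag n (k + 1)) (h0 : 0 < coord n k v) :
    diag (P ⊔ Submodule.span ℤ {v}) k = coord n k v := by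
  refine diag_eq h0 ?_
  rw [inf_eq_left.2 (sup_span_le hP hv), Submodule.map_sup, Submodule.map_span,
    Set.image_singleton, sup_eq_right]
  rintro _ ⟨p, hp, rfl⟩
  rw [coord_eq_zero (hP hp)]; exact zero_mem _

/-- Subtracting from `x ∈ R` the multiple of `v` with the same `k`-th coordinate leaves a vector of
`R ∩ ℚᵏ`. -/
theorem eq_sup_span (hR : R ≤ ratFlag n (k + 1)) (h0 : 0 < diag R k) (hv : v ∈ R)
    (hvd : coord n k v = diag R k) : R = (R ⊓ ratFlag n k) ⊔ Submodule.span ℤ {v} := by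
  refine le_antisymm (fun x hx => ?_) (sup_le inf_le_left (by simpa using hv))
  obtain ⟨z, hz⟩ := exists_coord_eq_mul h0 hx (hR hx)
  have hm : x - z • v ∈ R := sub_mem hx (R.smul_mem _ hv)
  refine mem_sup_span.2 ⟨x - z • v, ⟨hm, mem_ratFlag_of_coord (hR hm) ?_⟩, z, by simp⟩
  rw [map_sub, map_zsmul, hz, hvd, zsmul_eq_mul, sub_self]

/-- Extensions of `P` with a fixed last diagonal entry thus correspond to last vectors modulo `P`;
both fibre counts below rest on this. -/
theorem sup_span_eq_iff {w : Fin n → ℚ} (hP : P ≤ ratFlag n k) (h0 : coord n k v ≠ 0)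
    (hvw : coord n k v = coord n k w) :
    P ⊔ Submodule.span ℤ {v} = P ⊔ Submodule.span ℤ {w} ↔ v - w ∈ P := by
  constructor
  · intro h
    have hv : v ∈ P ⊔ Submodule.span ℤ {w} :=
      h ▸ Submodule.mem_sup_right (Submodule.mem_span_singleton_self v)
    obtain ⟨p, hp, z, rfl⟩ := mem_sup_span.1 hv
    rw [map_add, coord_eq_zero (hP hp), zero_add, map_zsmul, zsmul_eq_mul] at hvw
    have hw : coord n k w ≠ 0 := by
      intro h; rw [map_add, coord_eq_zero (hP hp), map_zsmul, h] at h0; simp at h0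
    have : (z : ℚ) = 1 := mul_right_cancel₀ hw (hvw.trans (one_mul _).symm)
    have : z = 1 := by exact_mod_cast this
    simpa [this] using hp
  · intro h
    refine le_antisymm (sup_le le_sup_left ?_) (sup_le le_sup_left ?_)
    · rw [Submodule.span_singleton_le_iff_mem]
      exact mem_sup_span.2 ⟨_, h, 1, by simp⟩
    · rw [Submodule.span_singleton_le_iff_mem]
      exact mem_sup_span.2 ⟨_, neg_mem h, 1, by simp⟩

end Extension

/-! ### Counting sublattices and overlattices -/

theorem card_eq_relIndex {V X : Type*} [AddCommGroup V] {A N : Submodule ℤ V} (f : A → X)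
    (hf : Function.Surjective f) (h : ∀ x y, f x = f y ↔ (x - y : V) ∈ N) :
    Nat.card X = N.toAddSubgroup.relIndex A.toAddSubgroup := by
  rw [AddSubgroup.relIndex, AddSubgroup.index]
  refine Nat.card_congr (Equiv.ofBijective
    (Quotient.lift f fun x y hxy => ?_ :
      A.toAddSubgroup ⧸ N.toAddSubgroup.addSubgroupOf A.toAddSubgroup → X) ⟨?_, ?_⟩).symm
  · rw [h, ← neg_mem_iff]
    have := QuotientAddGroup.leftRel_apply.1 hxy
    rw [AddSubgroup.mem_addSubgroupOf] at this
    convert! this using 1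
    simp; abel
  · rintro ⟨x⟩ ⟨y⟩ hxy
    refine QuotientAddGroup.eq.2 ?_
    have := neg_mem ((h x y).1 hxy)
    rw [AddSubgroup.mem_addSubgroupOf]
    convert! this using 1
    simp; abel
  · intro y
    obtain ⟨x, rfl⟩ := hf y
    exact ⟨Quotient.mk _ x, rfl⟩

theorem card_sigma_of_card_eq {Y : Type*} {F : Y → Type*} {c : ℕ} (hc : c ≠ 0)
    (h : ∀ y, Nat.card (F y) = c) : Nat.card (Σ y, F y) = Nat.card Y * c := by
  have e : (Σ y, F y) ≃ Y × Fin c :=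
    (Equiv.sigmaCongrRight fun y => (Nat.equivFinOfCardPos (h y ▸ hc)).trans
      (finCongr (h y))).trans (Equiv.sigmaEquivProd _ _)
  rw [Nat.card_congr e, Nat.card_prod, Nat.card_fin]

theorem card_eq_mul_of_fiber {X Y : Type*} (f : X → Y) {c : ℕ} (hc : c ≠ 0)
    (h : ∀ y, Nat.card {x // f x = y} = c) : Nat.card X = Nat.card Y * c := by
  rw [← card_sigma_of_card_eq hc h, Nat.card_congr (Equiv.sigmaFiberEquiv f)]

/-- Sublattices of `R` with prescribed intersection with `ℚᵏ` and prescribed last diagonal entry. -/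
theorem card_sub_fiber (hR : R ≤ ratFlag n (k + 1)) (hd : 0 < diag R k)
    (hP : P ≤ R ⊓ ratFlag n k) {m : ℕ} (hm : 0 < m) :
    Nat.card {L // L ≤ R ∧ L ⊓ ratFlag n k = P ∧ diag L k = m * diag R k} =
      P.toAddSubgroup.relIndex (R ⊓ ratFlag n k).toAddSubgroup := by
  obtain ⟨r, hr, hr', hrd⟩ := exists_coord_eq_diag hd
  have hmd : 0 < m * diag R k := by positivity
  have hc : ∀ x : ↥(R ⊓ ratFlag n k), coord n k (m • r + x.1) = m * diag R k := fun x => by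
    rw [map_add, coord_eq_zero x.2.2, map_nsmul, hrd, add_zero, nsmul_eq_mul]
  have hmem : ∀ x : ↥(R ⊓ ratFlag n k), m • r + x.1 ∈ R := fun x =>
    add_mem (nsmul_mem hr m) x.2.1
  have hP' := hP.trans inf_le_right
  -- The members of the fibre are `P + ℤ(m r + x)` with `x ∈ R ∩ ℚᵏ`, and `x` matters only modulo
  -- `P`.
  refine card_eq_relIndex (fun x => ⟨P ⊔ Submodule.span ℤ {m • r + x.1},
    sup_le (hP.trans inf_le_left) (by simpa using hmem x), sup_span_inf hP' ?_, ?_⟩) ?_ ?_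
  · rw [hc]; exact hmd.ne'
  · rw [diag_sup_span hP' (hR (hmem x)) (by rw [hc]; exact hmd), hc]
  · rintro ⟨L, hLR, hLP, hL⟩
    obtain ⟨v, hv, hv', hvd⟩ := exists_coord_eq_diag (hL ▸ hmd)
    have hx : v - m • r ∈ R ⊓ ratFlag n k := by
      have : v - m • r ∈ R := sub_mem (hLR hv) (nsmul_mem hr m)
      refine ⟨this, mem_ratFlag_of_coord (hR this) ?_⟩
      rw [map_sub, map_nsmul, hvd, hrd, hL, nsmul_eq_mul, sub_self]
    refine ⟨⟨_, hx⟩, Subtype.ext ?_⟩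
    have := eq_sup_span (hLR.trans hR) (hL ▸ hmd) hv hvd
    rw [hLP] at this
    simpa using this.symm
  · intro x y
    rw [Subtype.mk.injEq, sup_span_eq_iff hP' (by rw [hc]; exact hmd.ne') (by rw [hc, hc])]
    simp

/-- Overlattices of `L` in `ℚᵏ⁺¹` with prescribed intersection with `ℚᵏ` and prescribed last
diagonal entry. -/
theorem card_super_fiber (hL : L ≤ ratFlag n (k + 1)) (hd : 0 < diag L k)
    (hP : P ≤ ratFlag n k) (hLP : L ⊓ ratFlag n k ≤ P) {m : ℕ} (hm : 0 < m) :
    Nat.card {R // L ≤ R ∧ R ≤ ratFlag n (k + 1) ∧ R ⊓ ratFlag n k = P ∧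
        m * diag R k = diag L k} =
      P.toAddSubgroup.relIndex (P.comap (LinearMap.lsmul ℤ (Fin n → ℚ) m)).toAddSubgroup := by
  obtain ⟨l, hl, hl', hld⟩ := exists_coord_eq_diag hd
  have hm' : (m : ℚ) ≠ 0 := by positivity
  -- The last vector of an overlattice has `k`-th coordinate `diag L k / m`, so it is `l / m` plus
  -- some `x ∈ ℚᵏ`.
  set r : Fin n → ℚ := (m : ℚ)⁻¹ • l with hr
  have hmr : (m : ℤ) • r = l := by
    rw [hr, ← Int.cast_smul_eq_zsmul ℚ, smul_smul]; simp [hm']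
  have hrr : r ∈ ratFlag n (k + 1) := mem_ratFlag.2 fun i hi => by
    simp [hr, mem_ratFlag.1 hl' i hi]
  have hPm : ∀ x, x ∈ P.comap (LinearMap.lsmul ℤ (Fin n → ℚ) m) ↔ (m : ℤ) • x ∈ P := fun x => by
    simp
  have hPk : ∀ x, x ∈ P.comap (LinearMap.lsmul ℤ (Fin n → ℚ) m) → x ∈ ratFlag n k := by
    intro x hx
    refine mem_ratFlag.2 fun i hi => ?_
    have := mem_ratFlag.1 (hP ((hPm x).1 hx)) i hi
    simpa [hm.ne'] using this
  have hrc : m * coord n k r = diag L k := by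
    rw [← hld, ← hmr, map_zsmul, zsmul_eq_mul]; simp
  have hrpos : 0 < coord n k r := by
    have : 0 < (m : ℚ) * coord n k r := hrc ▸ hd
    exact pos_of_mul_pos_right this (by positivity)
  have hc : ∀ x : ↥(P.comap (LinearMap.lsmul ℤ (Fin n → ℚ) m)),
      coord n k (r + x.1) = coord n k r := fun x => by
    rw [map_add, coord_eq_zero (hPk _ x.2), add_zero]
  have hmem : ∀ x : ↥(P.comap (LinearMap.lsmul ℤ (Fin n → ℚ) m)), r + x.1 ∈ ratFlag n (k + 1) :=
    fun x => add_mem hrr (ratFlag_mono k.le_succ (hPk _ x.2))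
  -- Since `l = m (r + x) - m x`, the extension by `r + x` contains `l` exactly when `m x ∈ P`.
  -- Hence `x` runs over `m⁻¹P` modulo `P`.
  refine card_eq_relIndex (fun x => ⟨P ⊔ Submodule.span ℤ {r + x.1}, ?_,
    sup_span_le hP (hmem x), sup_span_inf hP (by rw [hc]; exact hrpos.ne'), ?_⟩) ?_ ?_
  · rw [eq_sup_span hL hd hl hld]
    refine sup_le (hLP.trans le_sup_left) ?_
    rw [Submodule.span_singleton_le_iff_mem]
    refine mem_sup_span.2 ⟨-((m : ℤ) • x.1), neg_mem ((hPm _).1 x.2), m, ?_⟩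
    rw [smul_add, hmr]; abel
  · rw [diag_sup_span hP (hmem x) (by rw [hc]; exact hrpos), hc, hrc]
  · rintro ⟨R, hLR, hRk, hRP, hRd⟩
    have hdR : diag R k = coord n k r := mul_left_cancel₀ hm' (hRd.trans hrc.symm)
    obtain ⟨v, hv, hv', hvd⟩ := exists_coord_eq_diag (hdR ▸ hrpos)
    have hx : v - r ∈ P.comap (LinearMap.lsmul ℤ (Fin n → ℚ) m) := by
      rw [hPm, smul_sub, hmr, ← hRP]
      have : (m : ℤ) • v - l ∈ R := sub_mem (R.smul_mem _ hv) (hLR hl)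
      refine ⟨this, mem_ratFlag_of_coord (hRk this) ?_⟩
      rw [map_sub, map_zsmul, hvd, hld, ← hRd]; simp
    refine ⟨⟨_, hx⟩, Subtype.ext ?_⟩
    have := eq_sup_span hRk (hdR ▸ hrpos) hv hvd
    rw [hRP] at this
    simpa using this.symm
  · intro x y
    rw [Subtype.mk.injEq, sup_span_eq_iff hP (by rw [hc]; exact hrpos.ne') (by rw [hc, hc])]
    simp

/-- The index of a sublattice of `R` is the product of the ratios of the diagonal entries. -/
theorem relIndex_eq_prod (a : ℕ → ℕ) (hR : R ≤ ratFlag n k) (hLR : L ≤ R)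
    (hd : ∀ i < k, 0 < diag R i) (ha : ∀ i < k, 0 < a i)
    (hL : ∀ i < k, diag L i = a i * diag R i) :
    L.toAddSubgroup.relIndex R.toAddSubgroup = ∏ i ∈ Finset.range k, a i := by
  induction k generalizing R L with
  | zero =>
    rw [ratFlag_zero] at hR
    rw [le_bot_iff.1 hR, Finset.prod_range_zero]
    exact L.toAddSubgroup.relIndex_bot_right
  | succ k ih =>
    have h1 := ih (R := R ⊓ ratFlag n k) (L := L ⊓ ratFlag n k) inf_le_right
      (inf_le_inf_right _ hLR) (fun i hi => by rw [diag_inf_ratFlag hi]; exact hd i (by omega))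
      (fun i hi => ha i (by omega))
      (fun i hi => by rw [diag_inf_ratFlag hi, diag_inf_ratFlag hi]; exact hL i (by omega))
    set R' := R ⊓ ratFlag n k with hR'
    have hRk := hd k k.lt_succ_self
    have hLk : 0 < diag L k := by
      rw [hL k k.lt_succ_self]; have := ha k k.lt_succ_self; positivity
    obtain ⟨r, hr, hr', hrd⟩ := exists_coord_eq_diag hRk
    obtain ⟨l, hl, hl', hld⟩ := exists_coord_eq_diag hLk
    -- Second isomorphism theorem: the index of `L` in `L + R'` is that of `L ∩ R' = L ∩ ℚᵏ` in
    -- `R'`, known by induction.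
    have e1 : L.toAddSubgroup.relIndex (L ⊔ R').toAddSubgroup = ∏ i ∈ Finset.range k, a i := by
      have : (L ⊔ R').toAddSubgroup = R'.toAddSubgroup ⊔ L.toAddSubgroup := by
        rw [sup_comm, Submodule.sup_toAddSubgroup]
      rw [this, AddSubgroup.relIndex_sup_right, ← h1, ← AddSubgroup.inf_relIndex_right]
      congr 1
      ext x
      simp only [AddSubgroup.mem_inf, Submodule.mem_toAddSubgroup, Submodule.mem_inf, hR']
      exact ⟨fun h => ⟨h.1, h.2.2⟩, fun h => ⟨h.1, hLR h.1, h.2⟩⟩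
    -- The quotient of `R` by `L + R'` is cyclic, generated by `r`; comparing `k`-th coordinates
    -- shows that its order is `a k`.
    have e2 : (L ⊔ R').toAddSubgroup.relIndex R.toAddSubgroup = a k := by
      have hRS : R.toAddSubgroup =
          (zmultiplesHom _ r).range ⊔ (L ⊔ R').toAddSubgroup := by
        ext x
        rw [AddSubgroup.mem_sup]
        constructor
        · intro hx
          rw [Submodule.mem_toAddSubgroup, eq_sup_span hR hRk hr hrd] at hx
          obtain ⟨p, hp, z, rfl⟩ := mem_sup_span.1 hx
          exact ⟨_, ⟨z, rfl⟩, p, Submodule.mem_sup_right hp, by simp [add_comm]⟩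
        · rintro ⟨_, ⟨z, rfl⟩, y, hy, rfl⟩
          exact add_mem (R.smul_mem z hr) ((sup_le hLR inf_le_left : L ⊔ R' ≤ R) hy)
      have hcm : (L ⊔ R').toAddSubgroup.comap (zmultiplesHom _ r) =
          AddSubgroup.zmultiples (a k : ℤ) := by
        ext z
        rw [AddSubgroup.mem_comap, Int.mem_zmultiples_iff, Submodule.mem_toAddSubgroup,
          zmultiplesHom_apply]
        constructor
        · intro hz
          obtain ⟨x, hx, y, hy, hxy⟩ := Submodule.mem_sup.1 hz
          obtain ⟨w, hw⟩ := exists_coord_eq_mul hLk hx (hR (hLR hx))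
          have := congrArg (coord n k) hxy
          rw [map_add, coord_eq_zero hy.2, hw, map_zsmul, hrd, hL k k.lt_succ_self, add_zero,
            zsmul_eq_mul, ← mul_assoc] at this
          have := mul_right_cancel₀ hRk.ne' this
          exact ⟨w, by rw [mul_comm]; exact_mod_cast this.symm⟩
        · rintro ⟨w, rfl⟩
          have h2 : (a k : ℤ) • r ∈ L ⊔ R' := by
            refine Submodule.mem_sup.2 ⟨l, hl, (a k : ℤ) • r - l, ?_, by abel⟩
            have : (a k : ℤ) • r - l ∈ R := sub_mem (R.smul_mem _ hr) (hLR hl)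
            refine ⟨this, mem_ratFlag_of_coord (hR this) ?_⟩
            rw [map_sub, map_zsmul, hrd, hld, hL k k.lt_succ_self]; simp
          rw [mul_comm, mul_smul]
          exact Submodule.smul_mem _ _ h2
      rw [hRS, AddSubgroup.relIndex_sup_right, AddMonoidHom.range_eq_map,
        ← AddSubgroup.relIndex_comap, hcm, AddSubgroup.relIndex_top_right, Int.index_zmultiples]
      simp
    rw [Finset.prod_range_succ, ← e1, ← e2]
    exact (AddSubgroup.relIndex_mul_relIndex _ _ _ (le_sup_left : L ≤ L ⊔ R')
      (sup_le hLR inf_le_left : L ⊔ R' ≤ R)).symm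

theorem diag_comap_lsmul {m : ℕ} (hm : 0 < m) {i : ℕ} (hd : 0 < diag P i) :
    diag (P.comap (LinearMap.lsmul ℤ (Fin n → ℚ) m)) i = diag P i / m := by
  have hm' : (m : ℚ) ≠ 0 := by positivity
  refine diag_eq (by positivity) (le_antisymm ?_ ?_)
  · rintro _ ⟨x, ⟨hx, hx'⟩, rfl⟩
    have hx : (m : ℤ) • x ∈ P := by simpa using hx
    obtain ⟨z, hz⟩ := exists_coord_eq_mul hd hx (Submodule.smul_mem _ _ hx')
    refine Submodule.mem_span_singleton.2 ⟨z, ?_⟩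
    rw [map_zsmul, zsmul_eq_mul] at hz
    push_cast at hz
    rw [zsmul_eq_mul]
    field_simp
    linarith
  · rw [Submodule.span_singleton_le_iff_mem]
    obtain ⟨v, hv, hv', hvd⟩ := exists_coord_eq_diag hd
    have hmv : (m : ℤ) • ((m : ℚ)⁻¹ • v) = v := by
      rw [← Int.cast_smul_eq_zsmul ℚ, smul_smul]; simp [hm']
    refine ⟨(m : ℚ)⁻¹ • v, ⟨?_, ?_⟩, ?_⟩
    · show (m : ℤ) • ((m : ℚ)⁻¹ • v) ∈ P
      rwa [hmv]
    · exact mem_ratFlag.2 fun j hj => by simp [mem_ratFlag.1 hv' j hj]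
    · have := congrArg (coord n i) hmv
      rw [map_zsmul, zsmul_eq_mul, hvd] at this
      push_cast at this
      rw [eq_div_iff hm', mul_comm]
      exact this

/-- Passing from `P` to `m⁻¹P` divides each of the `k` diagonal entries by `m`. -/
theorem relIndex_comap_lsmul (hP : P ≤ ratFlag n k) (hd : ∀ i < k, 0 < diag P i) {m : ℕ}
    (hm : 0 < m) : P.toAddSubgroup.relIndex
      (P.comap (LinearMap.lsmul ℤ (Fin n → ℚ) m)).toAddSubgroup = m ^ k := by
  have hm' : (m : ℚ) ≠ 0 := by positivity
  rw [relIndex_eq_prod (k := k) (fun _ => m), Finset.prod_const, Finset.card_range]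
  · intro x hx
    refine mem_ratFlag.2 fun i hi => ?_
    have := mem_ratFlag.1 (hP (show (m : ℤ) • x ∈ P from hx)) i hi
    simpa [hm.ne'] using this
  · exact fun x hx => P.smul_mem (m : ℤ) hx
  · intro i hi
    rw [diag_comap_lsmul hm (hd i hi)]
    have := hd i hi
    positivity
  · exact fun _ _ => hm
  · intro i hi
    rw [diag_comap_lsmul hm (hd i hi)]
    field_simp

/-- The number of sublattices with prescribed relative diagonal. -/
theorem card_sub (a : ℕ → ℕ) (hR : R ≤ ratFlag n k) (hd : ∀ i < k, 0 < diag R i)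
    (ha : ∀ i, 0 < a i) :
    Nat.card {L // L ≤ R ∧ ∀ i < k, diag L i = a i * diag R i} =
      ∏ i ∈ Finset.range k, a i ^ (k - 1 - i) := by
  induction k generalizing R with
  | zero =>
    have : Unique {L // L ≤ R ∧ ∀ i < 0, diag L i = a i * diag R i} :=
      { default := ⟨R, le_rfl, fun i hi => by omega⟩
        uniq := fun L => Subtype.ext
          (le_antisymm L.2.1 (hR.trans (ratFlag_zero.le.trans bot_le))) }
    rw [Finset.prod_range_zero]
    exact Nat.card_unique
  | succ k ih =>
    have hd' : ∀ i < k, 0 < diag (R ⊓ ratFlag n k) i := fun i hi => by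
      rw [diag_inf_ratFlag hi]; exact hd i (by omega)
    have h1 := ih (R := R ⊓ ratFlag n k) inf_le_right hd'
    -- Under `L ↦ L ∩ ℚᵏ`, every fibre has as many elements as the index of `P` in `R ∩ ℚᵏ`, which
    -- is `∏_{i<k} a_i` whatever `P` is. Each exponent with `i < k` grows by one.
    rw [card_eq_mul_of_fiber (c := ∏ i ∈ Finset.range k, a i)
      (Y := {L // L ≤ R ⊓ ratFlag n k ∧ ∀ i < k, diag L i = a i * diag (R ⊓ ratFlag n k) i})
      (fun L => ⟨L.1 ⊓ ratFlag n k, inf_le_inf_right _ L.2.1, fun i hi => by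
        rw [diag_inf_ratFlag hi, diag_inf_ratFlag hi]; exact L.2.2 i (by omega)⟩), h1,
      Finset.prod_range_succ, ← Finset.prod_mul_distrib]
    · have : k + 1 - 1 - k = 0 := by omega
      rw [this, pow_zero, mul_one]
      refine Finset.prod_congr rfl fun i hi => ?_
      rw [Finset.mem_range] at hi
      rw [← pow_succ]
      congr 1
      omega
    · exact Finset.prod_ne_zero_iff.2 fun i _ => (ha i).ne'
    · rintro ⟨P, hP, hPd⟩
      rw [← relIndex_eq_prod a inf_le_right hP hd' (fun i _ => ha i) hPd,
        ← card_sub_fiber hR (hd k k.lt_succ_self) hP (ha k)]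
      refine Nat.card_congr
        { toFun := fun L => ⟨L.1.1, L.1.2.1, congrArg Subtype.val L.2, L.1.2.2 k k.lt_succ_self⟩
          invFun := fun L => ⟨⟨L.1, L.2.1, fun i hi => ?_⟩, Subtype.ext L.2.2.1⟩
          left_inv := fun _ => rfl
          right_inv := fun _ => rfl }
      rcases Nat.lt_succ_iff_lt_or_eq.1 hi with hi | rfl
      · rw [← diag_inf_ratFlag hi, L.2.2.1, hPd i hi, diag_inf_ratFlag hi]
      · exact L.2.2.2

/-- The number of overlattices with prescribed relative diagonal. -/
theorem card_super (c : ℕ → ℕ) (hL : L ≤ ratFlag n k) (hd : ∀ i < k, 0 < diag L i)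
    (hc : ∀ i, 0 < c i) :
    Nat.card {R // L ≤ R ∧ R ≤ ratFlag n k ∧ ∀ i < k, c i * diag R i = diag L i} =
      ∏ i ∈ Finset.range k, c i ^ i := by
  induction k generalizing L with
  | zero =>
    have : Unique {R // L ≤ R ∧ R ≤ ratFlag n 0 ∧ ∀ i < 0, c i * diag R i = diag L i} :=
      { default := ⟨L, le_rfl, hL, fun i hi => by omega⟩
        uniq := fun R => Subtype.ext
          (le_antisymm (R.2.2.1.trans (ratFlag_zero.le.trans bot_le)) R.2.1) }
    rw [Finset.prod_range_zero]
    exact Nat.card_unique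
  | succ k ih =>
    have hd' : ∀ i < k, 0 < diag (L ⊓ ratFlag n k) i := fun i hi => by
      rw [diag_inf_ratFlag hi]; exact hd i (by omega)
    have h1 := ih (L := L ⊓ ratFlag n k) inf_le_right hd'
    -- Under `R ↦ R ∩ ℚᵏ`, every fibre has as many elements as the index of `P` in `(c k)⁻¹P`.
    rw [card_eq_mul_of_fiber (c := c k ^ k)
      (Y := {R // L ⊓ ratFlag n k ≤ R ∧ R ≤ ratFlag n k ∧
        ∀ i < k, c i * diag R i = diag (L ⊓ ratFlag n k) i})
      (fun R => ⟨R.1 ⊓ ratFlag n k, inf_le_inf_right _ R.2.1, inf_le_right, fun i hi => by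
        rw [diag_inf_ratFlag hi, diag_inf_ratFlag hi]; exact R.2.2.2 i (by omega)⟩), h1,
      Finset.prod_range_succ]
    · exact pow_ne_zero _ (hc k).ne'
    · rintro ⟨P, hLP, hP, hPd⟩
      have hPd' : ∀ i < k, 0 < diag P i := fun i hi =>
        pos_of_mul_pos_right ((hPd i hi).symm ▸ hd' i hi) (by positivity)
      rw [← relIndex_comap_lsmul hP hPd' (hc k),
        ← card_super_fiber hL (hd k k.lt_succ_self) hP hLP (hc k)]
      refine Nat.card_congr
        { toFun := fun R => ⟨R.1.1, R.1.2.1, R.1.2.2.1, congrArg Subtype.val R.2,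
            R.1.2.2.2 k k.lt_succ_self⟩
          invFun := fun R => ⟨⟨R.1, R.2.1, R.2.2.1, fun i hi => ?_⟩, Subtype.ext R.2.2.2.1⟩
          left_inv := fun _ => rfl
          right_inv := fun _ => rfl }
      rcases Nat.lt_succ_iff_lt_or_eq.1 hi with hi | rfl
      · rw [← diag_inf_ratFlag hi, R.2.2.2.1, hPd i hi, diag_inf_ratFlag hi]
      · exact R.2.2.2.2

/-! ### Triangular bases and covolumes -/

theorem realCoords_apply {n k : ℕ} (x : Fin n → ℚ) (i : Fin k) :
    realCoords n k x i = ((coord n i x : ℚ) : ℝ) := by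
  by_cases h : (i : ℕ) < n <;> simp [realCoords, coord, h]

theorem span_image_eq {b : ℕ → Fin n → ℚ} (hd : ∀ i < k, 0 < diag R i)
    (hb : ∀ i < k, b i ∈ R ∧ b i ∈ ratFlag n (i + 1) ∧ coord n i (b i) = diag R i) :
    Submodule.span ℤ (b '' Set.Iio k) = R ⊓ ratFlag n k := by
  induction k with
  | zero => simp [ratFlag_zero]
  | succ k ih =>
    obtain ⟨h1, h2, h3⟩ := hb k k.lt_succ_self
    have hk : diag (R ⊓ ratFlag n (k + 1)) k = diag R k := diag_inf_ratFlag k.lt_succ_self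
    rw [eq_sup_span (R := R ⊓ ratFlag n (k + 1)) (v := b k) inf_le_right
      (hk ▸ hd k k.lt_succ_self) ⟨h1, h2⟩ (hk ▸ h3), inf_assoc,
      inf_eq_right.2 (ratFlag_mono k.le_succ),
      ← ih (fun i hi => hd i (by omega)) (fun i hi => hb i (by omega)), ← Submodule.span_union]
    congr 1
    have : Set.Iio (k + 1) = Set.Iio k ∪ {k} := by ext i; simp
    rw [this, Set.image_union, Set.image_singleton]

/-- A lattice has a triangular basis. -/
theorem exists_triangular_basis (hd : ∀ i < k, 0 < diag R i) :
    ∃ (b : Fin k → Fin n → ℚ) (B : Module.Basis (Fin k) ℝ (Fin k → ℝ)),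
      Submodule.span ℤ (Set.range b) = R ⊓ ratFlag n k ∧ (∀ i, B i = realCoords n k (b i)) ∧
      (Matrix.of B).det = ∏ i ∈ Finset.range k, (diag R i : ℝ) := by
  have : ∀ i, ∃ v, i < k → v ∈ R ∧ v ∈ ratFlag n (i + 1) ∧ coord n i v = diag R i := fun i => by
    by_cases h : i < k
    · obtain ⟨v, hv⟩ := exists_coord_eq_diag (hd i h)
      exact ⟨v, fun _ => hv⟩
    · exact ⟨0, fun h' => absurd h' h⟩
  choose b hb using this
  let M : Matrix (Fin k) (Fin k) ℝ := Matrix.of fun i => realCoords n k (b i)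
  have hM : M.IsLowerTriangular := by
    intro i j hij
    have hij : i < j := hij
    have := (hb i i.2).2.1
    show realCoords n k (b i) j = 0
    rw [realCoords_apply]
    exact_mod_cast coord_eq_zero (ratFlag_mono (show (i : ℕ) + 1 ≤ j from hij) this)
  have hdet : M.det = ∏ i ∈ Finset.range k, (diag R i : ℝ) := by
    rw [Matrix.det_of_isLowerTriangular _ hM, Finset.prod_range]
    refine Finset.prod_congr rfl fun i _ => ?_
    show realCoords n k (b i) i = _
    rw [realCoords_apply, (hb i i.2).2.2]
  have hne : M.det ≠ 0 := by
    rw [hdet, Finset.prod_ne_zero_iff]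
    intro i hi
    exact_mod_cast (hd i (Finset.mem_range.1 hi)).ne'
  have hli : LinearIndependent ℝ M.row :=
    Matrix.linearIndependent_rows_iff_isUnit.2
      ((Matrix.isUnit_iff_isUnit_det M).2 (isUnit_iff_ne_zero.2 hne))
  let B := basisOfLinearIndependentOfCardEqFinrank' _ hli (by simp)
  have hB : ∀ i, B i = realCoords n k (b i) := fun i => by
    simp only [B, coe_basisOfLinearIndependentOfCardEqFinrank']
    rfl
  refine ⟨fun i => b i, B, ?_, hB, ?_⟩
  · rw [← span_image_eq hd hb]
    congr 1
    ext v
    simp only [Set.mem_range, Set.mem_image, Set.mem_Iio]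
    exact ⟨fun ⟨i, h⟩ => ⟨i, i.2, h⟩, fun ⟨i, hi, h⟩ => ⟨⟨i, hi⟩, h⟩⟩
  · rw [← hdet]
    congr 1
    ext i j
    simp [hB, M]

theorem torusVolume_inf_ratFlag (hd : ∀ i < k, 0 < diag R i) :
    torusVolume k (R ⊓ ratFlag n k) = ∏ i ∈ Finset.range k, (diag R i : ℝ) := by
  obtain ⟨b, B, hspan, hB, hdet⟩ := exists_triangular_basis hd
  have hmap : (R ⊓ ratFlag n k).map (realCoords n k) = Submodule.span ℤ (Set.range B) := by
    rw [← hspan, Submodule.map_span, ← Set.range_comp]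
    congr 2
    funext i
    exact (hB i).symm
  rw [torusVolume, hmap, ZLattice.covolume_eq_det _ (B.restrictScalars ℤ)]
  have : (Matrix.of ((↑) ∘ B.restrictScalars ℤ) : Matrix (Fin k) (Fin k) ℝ) = Matrix.of B := by
    ext i j; simp
  rw [this, hdet, abs_of_nonneg]
  exact Finset.prod_nonneg fun i hi => by exact_mod_cast (hd i (Finset.mem_range.1 hi)).le

/-- Together with `IsLattice.diag_pos`, this identifies lattices with the subgroups of positive
diagonal, so that the counts of subgroups become counts of lattices. -/
theorem isLattice_of_diag_pos (hd : ∀ i < n, 0 < diag R i) : IsLattice n R := by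
  obtain ⟨b, B, hspan, hB, -⟩ := exists_triangular_basis hd
  have hli : LinearIndependent ℤ b := by
    refine LinearIndependent.of_comp (realCoords n n) ?_
    have : ⇑(realCoords n n) ∘ b = B := funext fun i => (hB i).symm
    rw [this]
    exact B.linearIndependent.restrict_scalars' ℤ
  rw [ratFlag_top, inf_top_eq] at hspan
  exact ⟨(Module.Basis.span hli).map (LinearEquiv.ofEq _ _ hspan)⟩

/-! ### Positivity of the diagonal -/

/-- A nonzero subgroup of the cyclic group `ℤe` is cyclic, because it pulls back to a principal
ideal of `ℤ`; the sign of its generator can be chosen. -/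
theorem diag_pos {e : ℚ}
    (he : ∀ x ∈ R, x ∈ ratFlag n (k + 1) → coord n k x ∈ Submodule.span ℤ {e})
    {x : Fin n → ℚ} (hx : x ∈ R) (hx' : x ∈ ratFlag n (k + 1)) (h0 : coord n k x ≠ 0) :
    0 < diag R k := by
  set S := (R ⊓ ratFlag n (k + 1)).map (coord n k) with hS
  have hSe : S ≤ Submodule.span ℤ {e} := by
    rintro _ ⟨y, hy, rfl⟩; exact he y hy.1 hy.2
  obtain ⟨g, hg⟩ := (IsPrincipalIdealRing.principal
    (S.comap (LinearMap.toSpanSingleton ℤ ℚ e))).principal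
  have hSg : S = Submodule.span ℤ {(g : ℚ) * e} := by
    have h1 : S = (S.comap (LinearMap.toSpanSingleton ℤ ℚ e)).map
        (LinearMap.toSpanSingleton ℤ ℚ e) := by
      rw [Submodule.map_comap_eq, LinearMap.range_toSpanSingleton, inf_eq_right.2 hSe]
    rw [h1, hg, Submodule.map_span, Set.image_singleton, LinearMap.toSpanSingleton_apply,
      zsmul_eq_mul]
  have hg0 : (g : ℚ) * e ≠ 0 := by
    intro h
    rw [h, Submodule.span_zero_singleton] at hSg
    have : coord n k x ∈ S := Submodule.mem_map_of_mem ⟨hx, hx'⟩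
    rw [hSg] at this
    exact h0 (by simpa using this)
  have habs : S = Submodule.span ℤ {|(g : ℚ) * e|} := by
    rcases abs_choice ((g : ℚ) * e) with h | h <;> rw [h, hSg]
    rw [← Set.neg_singleton, Submodule.span_neg]
  rw [diag_eq (abs_pos.2 hg0) habs]
  exact abs_pos.2 hg0

theorem exists_nat_smul_mem {ι : Type*} {c : ι → Fin n → ℚ}
    (hc : Submodule.span ℚ (Set.range c) = ⊤) (hR : ∀ i, c i ∈ R) (x : Fin n → ℚ) :
    ∃ N : ℕ, 0 < N ∧ N • x ∈ R := by
  have hx : x ∈ Submodule.span ℚ (Set.range c) := hc ▸ Submodule.mem_top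
  induction hx using Submodule.span_induction with
  | mem x hx =>
    obtain ⟨i, rfl⟩ := hx
    exact ⟨1, one_pos, by simpa using hR i⟩
  | zero => exact ⟨1, one_pos, by simp⟩
  | add x y _ _ hx hy =>
    obtain ⟨N, hN, hx⟩ := hx
    obtain ⟨M, hM, hy⟩ := hy
    refine ⟨M * N, Nat.mul_pos hM hN, ?_⟩
    rw [smul_add, mul_smul, mul_comm, mul_smul]
    exact add_mem (nsmul_mem hx M) (nsmul_mem hy N)
  | smul q x _ hx =>
    obtain ⟨N, hN, hx⟩ := hx
    refine ⟨q.den * N, Nat.mul_pos q.den_pos hN, ?_⟩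
    have : (q.den * N) • q • x = q.num • N • x := by
      rw [← Nat.cast_smul_eq_nsmul ℚ, ← Nat.cast_smul_eq_nsmul ℚ N, ← Int.cast_smul_eq_zsmul ℚ,
        smul_smul, smul_smul]
      congr 1
      push_cast
      rw [mul_right_comm, Rat.den_mul_eq_num]
    rw [this]
    exact R.smul_mem _ hx

theorem IsLattice.diag_pos (h : IsLattice n R) {i : ℕ} (hi : i < n) : 0 < diag R i := by
  obtain ⟨b⟩ := h
  let c : Fin n → Fin n → ℚ := fun j => b j
  have hli : LinearIndependent ℤ c :=
    b.linearIndependent.map' R.subtype (Submodule.ker_subtype R)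
  have hspan : Submodule.span ℚ (Set.range c) = ⊤ :=
    ((LinearIndependent.iff_fractionRing ℤ ℚ).1 hli).span_eq_top_of_card_eq_finrank' (by simp)
  obtain ⟨N, hN, hNi⟩ := exists_nat_smul_mem hspan (fun j => (b j).2) (Pi.single ⟨i, hi⟩ 1)
  -- A common denominator of the `i`-th coordinates of the basis puts all `i`-th coordinates of `R`
  -- in `ℤ m⁻¹`.
  obtain ⟨⟨m, hm⟩, hmc⟩ := IsLocalization.exist_integer_multiples_of_finite
    (nonZeroDivisors ℤ) (fun j => c j ⟨i, hi⟩)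
  have hm0 : (m : ℚ) ≠ 0 := by exact_mod_cast nonZeroDivisors.ne_zero hm
  refine QLattice.diag_pos (e := (m : ℚ)⁻¹) (fun x hx _ => ?_) hNi (mem_ratFlag.2 fun j hj => ?_) ?_
  · have hRc : R = Submodule.span ℤ (Set.range c) := by
      have := congrArg (Submodule.map R.subtype) b.span_eq
      rw [Submodule.map_span, ← Set.range_comp, Submodule.map_top, Submodule.range_subtype] at this
      exact this.symm
    have hle : R ≤ (Submodule.span ℤ {(m : ℚ)⁻¹}).comap (coord n i) := by
      rw [hRc, Submodule.span_le]
      rintro _ ⟨j, rfl⟩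
      obtain ⟨z, hz⟩ := hmc j
      refine Submodule.mem_span_singleton.2 ⟨z, ?_⟩
      rw [coord_apply hi, zsmul_eq_mul]
      simp only [algebraMap_int_eq, eq_intCast, zsmul_eq_mul] at hz
      rw [hz]
      field_simp
    exact hle hx
  · have : j ≠ ⟨i, hi⟩ := by rintro rfl; simp at hj
    simp [this]
  · rw [coord_apply hi]
    simp [hN.ne']

theorem diag_inf_intFlag_pos {i : ℕ} (hd : 0 < diag R i) : 0 < diag (R ⊓ intFlag n n) i := by
  obtain ⟨v, hv, hv', hvd⟩ := exists_coord_eq_diag hd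
  obtain ⟨⟨m, hm⟩, hmv⟩ := IsLocalization.exist_integer_multiples_of_finite (nonZeroDivisors ℤ) v
  have hm0 : (m : ℚ) ≠ 0 := by exact_mod_cast nonZeroDivisors.ne_zero hm
  refine diag_pos (e := diag R i) (x := m • v) (fun x hx hx' => ?_) ⟨R.smul_mem m hv, ?_⟩
    (Submodule.smul_mem _ _ hv') ?_
  · obtain ⟨z, hz⟩ := exists_coord_eq_mul hd hx.1 hx'
    exact Submodule.mem_span_singleton.2 ⟨z, by rw [hz, zsmul_eq_mul]⟩
  · refine mem_intFlag.2 ⟨by simp [ratFlag_top], fun j => ?_⟩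
    obtain ⟨z, hz⟩ := hmv j
    exact ⟨z, by simpa using hz.symm⟩
  · rw [map_zsmul, hvd, zsmul_eq_mul]
    exact mul_ne_zero hm0 hd.ne'

theorem diag_intFlag {i : ℕ} (hi : i < n) : diag (intFlag n n) i = 1 := by
  refine diag_eq one_pos (le_antisymm ?_ ?_)
  · rintro _ ⟨x, ⟨hx, -⟩, rfl⟩
    obtain ⟨z, hz⟩ := (mem_intFlag.1 hx).2 ⟨i, hi⟩
    rw [coord_apply hi, hz]
    exact Submodule.mem_span_singleton.2 ⟨z, by simp⟩
  · rw [Submodule.span_singleton_le_iff_mem]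
    refine ⟨Pi.single ⟨i, hi⟩ 1, ⟨Submodule.subset_span ⟨⟨i, hi⟩, hi, rfl⟩,
      Submodule.subset_span ⟨⟨i, hi⟩, i.lt_succ_self, rfl⟩⟩, ?_⟩
    simp [coord_apply hi]

theorem exists_diag_eq_mul (hLR : L ≤ R) (hL : 0 < diag L k) (hR : 0 < diag R k) :
    ∃ a : ℕ+, diag L k = a * diag R k := by
  obtain ⟨v, hv, hv', hvd⟩ := exists_coord_eq_diag hL
  obtain ⟨z, hz⟩ := exists_coord_eq_mul hR (hLR hv) hv'
  have hz0 : 0 < z := by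
    have : 0 < (z : ℚ) := pos_of_mul_pos_left (hz ▸ hvd ▸ hL) hR.le
    exact_mod_cast this
  lift z to ℕ using hz0.le
  exact ⟨⟨z, by exact_mod_cast hz0⟩, by rw [← hvd, hz]; simp⟩

/-! ### The series in terms of diagonals -/

/-- The entry `d i` occurs in the partial products with `k > i`, where the exponents telescope to
`-γ (i + 1) + γ (n + 1)`. Keeping the last factor makes the induction work; positivity allows the
complex powers to be split. -/
theorem prod_flag_cpow {n : ℕ} (d : ℕ → ℝ) (hd : ∀ i < n, 0 < d i) (γ : ℕ → ℂ) :
    ∏ k ∈ Finset.Icc 1 n, ((∏ i ∈ Finset.range k, d i : ℝ) : ℂ) ^ (-γ k + γ (k + 1)) =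
      (∏ i ∈ Finset.range n, (d i : ℂ) ^ (-γ (i + 1))) *
        ((∏ i ∈ Finset.range n, d i : ℝ) : ℂ) ^ γ (n + 1) := by
  induction n with
  | zero => simp
  | succ n ih =>
    have hD : 0 < ∏ i ∈ Finset.range n, d i :=
      Finset.prod_pos fun i hi => hd i (by have := Finset.mem_range.1 hi; omega)
    have hdn := hd n n.lt_succ_self
    rw [Finset.prod_Icc_succ_top (by omega), ih fun i hi => hd i (by omega)]
    rw [Finset.prod_range_succ, Finset.prod_range_succ]
    set D := ∏ i ∈ Finset.range n, d i
    have hDd : ((D * d n : ℝ) : ℂ) ≠ 0 := by exact_mod_cast (mul_pos hD hdn).ne'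
    have hD0 : (D : ℂ) ≠ 0 := by exact_mod_cast hD.ne'
    rw [Complex.cpow_add _ _ hDd]
    have e : ((D * d n : ℝ) : ℂ) ^ (-γ (n + 1)) =
        (D : ℂ) ^ (-γ (n + 1)) * (d n : ℂ) ^ (-γ (n + 1)) := by
      rw [Complex.ofReal_mul, Complex.mul_cpow_ofReal_nonneg hD.le hdn.le]
    have e' : (D : ℂ) ^ γ (n + 1) * (D : ℂ) ^ (-γ (n + 1)) = 1 := by
      rw [← Complex.cpow_add _ _ hD0, add_neg_cancel, Complex.cpow_zero]
    rw [e]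
    linear_combination (∏ i ∈ Finset.range n, (d i : ℂ) ^ (-γ (i + 1))) *
      (d n : ℂ) ^ (-γ (n + 1)) * ((D * d n : ℝ) : ℂ) ^ γ (n + 1 + 1) * e'

theorem pnat_pow_mul_cpow (a : ℕ+) (e : ℕ) (s : ℂ) :
    (a : ℂ) ^ e * (a : ℂ) ^ (-s) = (a : ℂ) ^ (-(s - e)) := by
  rw [neg_sub, sub_eq_add_neg, Complex.cpow_add _ _ (by exact_mod_cast a.ne_zero),
    Complex.cpow_natCast]

/-- Extension of a family of positive integers by one. -/
def extendOne (a : Fin n → ℕ+) (i : ℕ) : ℕ := if h : i < n then a ⟨i, h⟩ else 1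

theorem extendOne_pos (a : Fin n → ℕ+) (i : ℕ) : 0 < extendOne a i := by
  unfold extendOne; split_ifs <;> simp

@[simp] theorem extendOne_fin (a : Fin n → ℕ+) (i : Fin n) : extendOne a i = a i := by
  simp [extendOne]

theorem forall_lt_iff_fin {p : ℕ → Prop} : (∀ i < n, p i) ↔ ∀ i : Fin n, p i :=
  ⟨fun h i => h i i.2, fun h i hi => h ⟨i, hi⟩⟩

/-- Sublattices are grouped by their diagonal `a` relative to `M`; the multiplicity `∏ a_i^(n-1-i)`
shifts the exponents of the zeta series. -/
theorem hasSum_sublattices {M : Submodule ℤ (Fin n → ℚ)} (hM : ∀ i < n, 0 < diag M i)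
    (s : Fin n → ℂ) (hs : ∀ i : Fin n, 1 < (s i - (n - 1 - i : ℕ)).re) :
    HasSum (fun L : {L : Lat n // L.1 ≤ M} => ∏ i : Fin n, ((diag L.1.1 i : ℝ) : ℂ) ^ (-s i))
      ((∏ i : Fin n, ((diag M i : ℝ) : ℂ) ^ (-s i)) *
        ∏ i : Fin n, riemannZeta (s i - (n - 1 - i : ℕ))) := by
  have hex : ∀ L : {L : Lat n // L.1 ≤ M}, ∀ i : Fin n,
      ∃ a : ℕ+, diag L.1.1 i = a * diag M i := fun L i =>
    exists_diag_eq_mul L.2 (L.1.2.diag_pos i.2) (hM i i.2)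
  choose π hπ using hex
  have hπ' : ∀ L a, π L = a ↔ ∀ i : Fin n, diag L.1.1 i = a i * diag M i := by
    refine fun L a => ⟨fun h i => h ▸ hπ L i, fun h => funext fun i => ?_⟩
    have := mul_right_cancel₀ (hM i i.2).ne' ((hπ L i).symm.trans (h i))
    exact_mod_cast this
  have key := hasSum_comp_of_card_fiber π (fun a => ∏ i : Fin n, (a i : ℕ) ^ (n - 1 - i : ℕ))
    (fun a => ?_) (fun a => Finset.prod_ne_zero_iff.2 fun i _ => by positivity)
    (fun a => ∏ i : Fin n, ((a i * diag M i : ℝ) : ℂ) ^ (-s i))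
    (S := (∏ i : Fin n, ((diag M i : ℝ) : ℂ) ^ (-s i)) *
        ∏ i : Fin n, riemannZeta (s i - (n - 1 - i : ℕ))) ?_
  · convert! key using 4 with L i
    rw [hπ L i]; push_cast; rfl
  · have hc := card_sub (R := M) (extendOne a) (by simp [ratFlag_top]) hM (extendOne_pos a)
    rw [Finset.prod_range] at hc
    simp only [extendOne_fin] at hc
    rw [← hc]
    refine Nat.card_congr
      { toFun := fun L => ⟨L.1.1.1, L.1.2, forall_lt_iff_fin.2 fun i => ?_⟩
        invFun := fun L => ⟨⟨⟨L.1, isLattice_of_diag_pos fun i hi => ?_⟩, L.2.1⟩,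
          (hπ' _ _).2 fun i => ?_⟩
        left_inv := fun _ => rfl
        right_inv := fun _ => rfl }
    · rw [extendOne_fin]; exact (hπ' _ _).1 L.2 i
    · rw [L.2.2 i hi]
      have := hM i hi
      have := extendOne_pos a i
      positivity
    · rw [L.2.2 i i.2, extendOne_fin]
  · convert! (hasSum_prod_pnat_cpow _ hs).mul_left
      (∏ i : Fin n, ((diag M i : ℝ) : ℂ) ^ (-s i)) using 2 with a
    push_cast
    rw [← Finset.prod_mul_distrib, ← Finset.prod_mul_distrib]
    refine Finset.prod_congr rfl fun i _ => ?_
    rw [← pnat_pow_mul_cpow]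
    have := Complex.mul_cpow_ofReal_nonneg (a := (a i : ℕ)) (b := (diag M i : ℝ))
      (by positivity) (by exact_mod_cast (hM i i.2).le) (-s i)
    push_cast at this
    rw [this]
    ring

/-- The sum over all pairs `L ⊆ R` of lattices with `L ⊆ ℤⁿ`. -/
theorem hasSum_pairs (s t : Fin n → ℂ)
    (hst : ∀ i : Fin n, 1 < (s i + t i - (n - 1 - i : ℕ)).re)
    (ht : ∀ i : Fin n, 1 < (-t i - (i : ℕ)).re) :
    HasSum (fun x : Σ R : Lat n, {L : Lat n // L.1 ≤ R.1 ⊓ intFlag n n} =>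
        (∏ i : Fin n, ((diag x.1.1 i : ℝ) : ℂ) ^ (-t i)) *
          ∏ i : Fin n, ((diag x.2.1.1 i : ℝ) : ℂ) ^ (-s i))
      ((∏ i : Fin n, riemannZeta (s i + t i - (n - 1 - i : ℕ))) *
        ∏ i : Fin n, riemannZeta (-t i - (i : ℕ))) := by
  have hI : ∀ i < n, 0 < diag (intFlag n n) i := fun i hi => by simp [diag_intFlag hi]
  have hexa : ∀ x : Σ R : Lat n, {L : Lat n // L.1 ≤ R.1 ⊓ intFlag n n}, ∀ i : Fin n,
      ∃ a : ℕ+, diag x.2.1.1 i = a * diag (intFlag n n) i := fun x i =>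
    exists_diag_eq_mul (x.2.2.trans inf_le_right) (x.2.1.2.diag_pos i.2) (hI i i.2)
  have hexc : ∀ x : Σ R : Lat n, {L : Lat n // L.1 ≤ R.1 ⊓ intFlag n n}, ∀ i : Fin n,
      ∃ c : ℕ+, diag x.2.1.1 i = c * diag x.1.1 i := fun x i =>
    exists_diag_eq_mul (x.2.2.trans inf_le_left) (x.2.1.2.diag_pos i.2) (x.1.2.diag_pos i.2)
  choose α hα using hexa
  choose γ hγ using hexc
  have hα' : ∀ x a, α x = a ↔ ∀ i : Fin n, diag x.2.1.1 i = a i * diag (intFlag n n) i := by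
    refine fun x a => ⟨fun h i => h ▸ hα x i, fun h => funext fun i => ?_⟩
    have := mul_right_cancel₀ (hI i i.2).ne' ((hα x i).symm.trans (h i))
    exact_mod_cast this
  have hγ' : ∀ x c, γ x = c ↔ ∀ i : Fin n, diag x.2.1.1 i = c i * diag x.1.1 i := by
    refine fun x a => ⟨fun h i => h ▸ hγ x i, fun h => funext fun i => ?_⟩
    have := mul_right_cancel₀ (x.1.2.diag_pos i.2).ne' ((hγ x i).symm.trans (h i))
    exact_mod_cast this
  -- Here `a` is the diagonal of `L`, and `c` that of `L` relative to `R`. So `R` has diagonal `a_i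
  -- / c_i`, and the summand is `∏ a_i^(-(s_i + t_i)) c_i^(t_i)`.
  have key := hasSum_comp_of_card_fiber (fun x => (α x, γ x))
    (fun y => (∏ i : Fin n, (y.1 i : ℕ) ^ (n - 1 - i : ℕ)) * ∏ i : Fin n, (y.2 i : ℕ) ^ (i : ℕ))
    (fun y => ?_) (fun y => mul_ne_zero (Finset.prod_ne_zero_iff.2 fun i _ => by positivity)
      (Finset.prod_ne_zero_iff.2 fun i _ => by positivity))
    (fun y => (∏ i : Fin n, (y.1 i : ℂ) ^ (-(s i + t i))) * ∏ i : Fin n, (y.2 i : ℂ) ^ (-(-t i)))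
    (S := (∏ i : Fin n, riemannZeta (s i + t i - (n - 1 - i : ℕ))) *
        ∏ i : Fin n, riemannZeta (-t i - (i : ℕ))) ?_
  · convert! key using 2 with x
    simp only [← Finset.prod_mul_distrib]
    refine Finset.prod_congr rfl fun i _ => ?_
    have ha := hα x i
    rw [diag_intFlag i.2, mul_one] at ha
    have hc := (hγ x i).symm.trans ha
    have hR : (0 : ℚ) < diag x.1.1 i := x.1.2.diag_pos i.2
    have h1 : ((α x i : ℕ) : ℂ) ^ (-t i) =
        ((γ x i : ℕ) : ℂ) ^ (-t i) * ((diag x.1.1 i : ℝ) : ℂ) ^ (-t i) := by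
      have := Complex.mul_cpow_ofReal_nonneg (a := (γ x i : ℕ)) (b := (diag x.1.1 i : ℝ))
        (by positivity) (by exact_mod_cast hR.le) (-t i)
      rw [← Complex.ofReal_mul] at this
      have hc' : ((γ x i : ℕ) : ℝ) * (diag x.1.1 i : ℝ) = (α x i : ℕ) := by exact_mod_cast hc
      rw [hc'] at this
      exact_mod_cast this
    have hα0 : ((α x i : ℕ) : ℂ) ≠ 0 := by exact_mod_cast (α x i).ne_zero
    have hγ0 : ((γ x i : ℕ) : ℂ) ≠ 0 := by exact_mod_cast (γ x i).ne_zero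
    have h2 : ((γ x i : ℕ) : ℂ) ^ (-t i) * ((γ x i : ℕ) : ℂ) ^ (-(-t i)) = 1 := by
      rw [← Complex.cpow_add _ _ hγ0, add_neg_cancel, Complex.cpow_zero]
    rw [ha, neg_add, Complex.cpow_add _ _ hα0, h1]
    push_cast
    linear_combination (-(((diag x.1.1 i : ℚ) : ℂ) ^ (-t i) * ((α x i : ℕ) : ℂ) ^ (-s i))) * h2
  · obtain ⟨a, c⟩ := y
    have hca := card_sub (R := intFlag n n) (extendOne a) (by simp [ratFlag_top]) hI
      (extendOne_pos a)
    have hLpos : ∀ L : {L // L ≤ intFlag n n ∧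
        ∀ i < n, diag L i = extendOne a i * diag (intFlag n n) i}, ∀ i < n, 0 < diag L.1 i := by
      intro L i hi
      rw [L.2.2 i hi, diag_intFlag hi]
      have := extendOne_pos a i
      positivity
    have hcc := fun L : {L // L ≤ intFlag n n ∧
        ∀ i < n, diag L i = extendOne a i * diag (intFlag n n) i} =>
      card_super (L := L.1) (extendOne c) (by simp [ratFlag_top]) (hLpos L) (extendOne_pos c)
    have hne : ∏ i ∈ Finset.range n, extendOne c i ^ i ≠ 0 :=
      Finset.prod_ne_zero_iff.2 fun i _ => pow_ne_zero _ (extendOne_pos c i).ne'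
    -- The number of overlattices `R` does not depend on `L`, so the two counts multiply.
    have hprod := card_sigma_of_card_eq hne hcc
    rw [hca] at hprod
    simp only [Finset.prod_range, extendOne_fin] at hprod
    rw [← hprod]
    refine Nat.card_congr
      { toFun := fun x => ⟨⟨x.1.2.1.1, x.1.2.2.trans inf_le_right, forall_lt_iff_fin.2 fun i => ?_⟩,
          ⟨x.1.1.1, x.1.2.2.trans inf_le_left, by simp [ratFlag_top],
            forall_lt_iff_fin.2 fun i => ?_⟩⟩
        invFun := fun y => ⟨⟨⟨y.2.1, isLattice_of_diag_pos fun i hi => ?_⟩,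
          ⟨⟨y.1.1, isLattice_of_diag_pos (hLpos y.1)⟩, le_inf y.2.2.1 y.1.2.1⟩⟩,
          Prod.ext ((hα' _ _).2 fun i => ?_) ((hγ' _ _).2 fun i => ?_)⟩
        left_inv := fun _ => rfl
        right_inv := fun _ => rfl }
    · rw [extendOne_fin]; exact (hα' _ _).1 (congrArg Prod.fst x.2) i
    · rw [extendOne_fin]; exact ((hγ' _ _).1 (congrArg Prod.snd x.2) i).symm
    · exact pos_of_mul_pos_right (y.2.2.2.2 i hi ▸ hLpos y.1 i hi) (by positivity)
    · rw [y.1.2.2 i i.2, extendOne_fin]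
    · rw [← y.2.2.2.2 i i.2, extendOne_fin]
  · have h1 := hasSum_mul_complex (hasSum_prod_pnat_cpow _ hst) (hasSum_prod_pnat_cpow _ ht)
    convert! h1 using 2 with y
    push_cast
    simp only [← Finset.prod_mul_distrib]
    refine Finset.prod_congr rfl fun i _ => ?_
    rw [← pnat_pow_mul_cpow, ← pnat_pow_mul_cpow]
    ring

theorem prod_Icc_eq_prod_fin (f : ℕ → ℂ) : ∏ j ∈ Finset.Icc 1 n, f j = ∏ i : Fin n, f (i + 1) := by
  rw [← Finset.prod_range (fun i => f (i + 1)), Finset.range_eq_Ico,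
    Finset.prod_Ico_add' f 0 n 1]
  rfl

theorem summand_eq (R : Lat n) (α β : ℕ → ℂ) (hα : α (n + 1) = 0) (hβ : β (n + 1) = 0) :
    ∏ k ∈ Finset.Icc 1 n,
        ((torusVolume k (R.1 ⊓ ratFlag n k) : ℝ) : ℂ) ^ (-β k + β (k + 1)) *
        ((torusVolume k (R.1 ⊓ intFlag n k) : ℝ) : ℂ) ^ (-α k + α (k + 1)) =
      (∏ i : Fin n, ((diag R.1 i : ℝ) : ℂ) ^ (-β (i + 1))) *
        ∏ i : Fin n, ((diag (R.1 ⊓ intFlag n n) i : ℝ) : ℂ) ^ (-α (i + 1)) := by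
  have hR : ∀ i < n, 0 < diag R.1 i := fun i hi => R.2.diag_pos hi
  have hI : ∀ i < n, 0 < diag (R.1 ⊓ intFlag n n) i := fun i hi => diag_inf_intFlag_pos (hR i hi)
  have h1 := prod_flag_cpow (fun i => (diag R.1 i : ℝ)) (fun i hi => by exact_mod_cast hR i hi) β
  have h2 := prod_flag_cpow (fun i => (diag (R.1 ⊓ intFlag n n) i : ℝ))
    (fun i hi => by exact_mod_cast hI i hi) α
  rw [hβ, Complex.cpow_zero, mul_one, Finset.prod_range] at h1
  rw [hα, Complex.cpow_zero, mul_one, Finset.prod_range] at h2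
  rw [Finset.prod_mul_distrib, ← h1, ← h2]
  congr 1 <;> refine Finset.prod_congr rfl fun k hk => ?_ <;> rw [Finset.mem_Icc] at hk
  · rw [torusVolume_inf_ratFlag fun i hi => hR i (by omega)]
  · rw [intFlag_eq k, ← inf_assoc, torusVolume_inf_ratFlag fun i hi => hI i (by omega)]

end QLattice

theorem theorem2p13 (n : ℕ) (α β : ℕ → ℂ)
    (hα_last : α (n + 1) = 0) (hβ_last : β (n + 1) = 0)
    (hα : ∀ j ∈ Finset.Icc 1 n, 1 < (α j).re - n + 1)
    (hαβ : ∀ j ∈ Finset.Icc 1 n, 1 < (α j).re + (β j).re - n + j)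
    (hβ : ∀ j ∈ Finset.Icc 1 n, (β j).re + j < 0) :
    HasSum
      (fun R : QLattice.Lat n =>
        ∏ k ∈ Finset.Icc 1 n,
          ((QLattice.torusVolume k (R.1 ⊓ QLattice.ratFlag n k) : ℝ) : ℂ) ^ (-β k + β (k + 1)) *
          ((QLattice.torusVolume k (R.1 ⊓ QLattice.intFlag n k) : ℝ) : ℂ) ^ (-α k + α (k + 1)))
      (∏ j ∈ Finset.Icc 1 n,
        riemannZeta (-(β j + j - 1)) * riemannZeta (α j + β j - n + j) /
          riemannZeta (α j - n + j)) := by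
  have hmem : ∀ i : Fin n, (i : ℕ) + 1 ∈ Finset.Icc 1 n := fun i =>
    Finset.mem_Icc.2 ⟨by omega, i.2⟩
  have hcast : ∀ i : Fin n, ((n - 1 - i : ℕ) : ℂ) = n - ((i : ℕ) + 1 : ℕ) := fun i => by
    rw [← Nat.cast_sub i.2]
    congr 1
    omega
  have hα' : ∀ i : Fin n, 1 < (α (i + 1) - (n - 1 - i : ℕ)).re := fun i => by
    have := hα _ (hmem i)
    rw [hcast]
    simp only [Complex.sub_re, Complex.natCast_re]
    push_cast
    -- With `j = i + 1`, the bound on `Re α_j - n + 1` implies the one on `Re α_j - n + j`.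
    have : (0 : ℝ) ≤ (i : ℕ) := by positivity
    linarith
  have hαβ' : ∀ i : Fin n, 1 < (α (i + 1) + β (i + 1) - (n - 1 - i : ℕ)).re := fun i => by
    have := hαβ _ (hmem i)
    rw [hcast]
    simp only [Complex.sub_re, Complex.add_re, Complex.natCast_re]
    linarith
  have hβ' : ∀ i : Fin n, 1 < (-β (i + 1) - (i : ℕ)).re := fun i => by
    have := hβ _ (hmem i)
    simp only [Complex.sub_re, Complex.neg_re, Complex.natCast_re]
    push_cast at this
    linarith
  have hpairs := QLattice.hasSum_pairs (fun i : Fin n => α (i + 1)) (fun i => β (i + 1)) hαβ' hβ'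
  have hfib : ∀ R : QLattice.Lat n, HasSum
      (fun L : {L : QLattice.Lat n // L.1 ≤ R.1 ⊓ QLattice.intFlag n n} =>
        (∏ i : Fin n, ((QLattice.diag R.1 i : ℝ) : ℂ) ^ (-β (i + 1))) *
          ∏ i : Fin n, ((QLattice.diag L.1.1 i : ℝ) : ℂ) ^ (-α (i + 1)))
      ((∏ i : Fin n, ((QLattice.diag R.1 i : ℝ) : ℂ) ^ (-β (i + 1))) *
        ((∏ i : Fin n, ((QLattice.diag (R.1 ⊓ QLattice.intFlag n n) i : ℝ) : ℂ) ^ (-α (i + 1))) *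
          ∏ i : Fin n, riemannZeta (α (i + 1) - (n - 1 - i : ℕ)))) := fun R =>
    (QLattice.hasSum_sublattices (fun i hi => QLattice.diag_inf_intFlag_pos (R.2.diag_pos hi))
      (fun i => α (i + 1)) hα').mul_left _
  -- The sum over pairs converges unconditionally, so it may be evaluated by summing over `L` first,
  -- for fixed `R`.
  have hR := hpairs.sigma hfib
  have hZ : ∏ i : Fin n, riemannZeta (α (i + 1) - (n - 1 - i : ℕ)) ≠ 0 :=
    Finset.prod_ne_zero_iff.2 fun i _ => riemannZeta_ne_zero_of_one_lt_re (hα' i)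
  convert! hR.div_const (∏ i : Fin n, riemannZeta (α (i + 1) - (n - 1 - i : ℕ))) using 1
  · funext R
    rw [QLattice.summand_eq R α β hα_last hβ_last, ← mul_assoc, mul_div_cancel_right₀ _ hZ]
  · rw [QLattice.prod_Icc_eq_prod_fin, ← Finset.prod_mul_distrib, ← Finset.prod_div_distrib]
    refine Finset.prod_congr rfl fun i _ => ?_
    rw [hcast, mul_comm]
    congr 2
    · congr 1; ring
    · congr 1; push_cast; ring
    · ring
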